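/- Let $H,K$ be complex Hilbert spaces. For $w\in H\otimes K$ (algebraic tensor product) let $\|w\|_\pi=\inf\sum_i\|x_i\|\|y_i\|$ over all finite representations $w=\sum_i x_i\otimes y_i$. An \emph{orthogonal representation} of $w$ is $w=\sum_{i=1}^n\xi_i\otimes\eta_i$ with nonzero pairwise orthogonal $\xi_i\in H$, nonzero pairwise orthogonal $\eta_i\in K$, and $\|w\|_\pi=\sum_i\|\xi_i\|^2=\sum_i\|\eta_i\|^2$. Let $C,E\in B(H)$ and $D,F\in B(K)$ be invertible. We say that $(C,D)$ and $(E,F)$ satisfy the condition $U=S$ if for every $w\in H\otimes K$ there are an orthogonal representation $w=\sum_{i=1}^n\xi_i\otimes\eta_i$, orthogonal representations $(C\otimes D)w=\sum_{j=1}^n\rho_j\otimes\sigma_j$ and $(E\otimes F)w=\sum_{j=1}^n\tilde\rho_j\otimes\tilde\sigma_j$, and matrices $\alpha,\tilde\alpha\in M_n(\mathbb C)$ with $C\xi_i=\sum_j\alpha_{ij}\rho_j$ and $E\xi_i=\sum_j\tilde\alpha_{ij}\tilde\rho_j$, which have singular value decompositions $\alpha=UdV$, $\tilde\alpha=SeT$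 ($U,V,S,T$ unitary, $d,e$ diagonal with strictly positive entries) such that $U=S$. Let $A,C,E\in B(H)$, $B,D,F\in B(K)$, and let $u:H\times K\to\mathbb C$ be a bilinear form with $$|u(x,y)|\le\|Ax\|\|By\|+\|Cx\|\|Dy\|+\|Ex\|\|Fy\|\qquad(x\in H,\ y\in K).$$ Assume that one of the following holds: (i) $A,B,C,D,E,F$ are invertible, and $(CA^{-1},DB^{-1})$ and $(EA^{-1},FB^{-1})$ satisfy the condition $U=S$ (for $A=B=I$ this is the condition for $(C,D)$ and $(E,F)$ themselves); (ii) the operators are arbitrary and, writing $X(\varepsilon)=(X^*X+\varepsilon I)^{1/2}$, there are arbitrarily small $\varepsilon>0$ for which $(C(\varepsilon)A(\varepsilon)^{-1},D(\varepsilon)B(\varepsilon)^{-1})$ and $(E(\varepsilon)A(\varepsilon)^{-1},F(\varepsilon)B(\varepsilon)^{-1})$ satisfy the condition $U=S$. Then there are bilinear forms $u_1,u_2,u_3:H\times K\to\mathbb C$ with $u=u_1+u_2+u_3$ and, for all $x\in H$, $y\in K$, $$|u_1(x,y)|\le\|Ax\|\|By\|,\qquad |u_2(x,y)|\le\|Cx\|\|Dy\|,\qquad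 |u_3(x,y)|\le\|Ex\|\|Fy\|.$$ -/

import Mathlib

open Filter Topology
open scoped TensorProduct

/-- The projective norm `‖w‖_π` on the algebraic tensor product of two complex normed spaces:
the infimum of `∑ ‖x i‖ * ‖y i‖` over all finite representations `w = ∑ x i ⊗ y i`. -/
noncomputable def projNorm {H K : Type*}
    [NormedAddCommGroup H] [InnerProductSpace ℂ H]
    [NormedAddCommGroup K] [InnerProductSpace ℂ K] (w : H ⊗[ℂ] K) : ℝ :=
  sInf {r : ℝ | ∃ (n : ℕ) (x : Fin n → H) (y : Fin n → K),
    w = ∑ i, x i ⊗ₜ[ℂ] y i ∧ r = ∑ i, ‖x i‖ * ‖y i‖}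

/-- `w = ∑ ξ i ⊗ η i` with nonzero, pairwise orthogonal vectors `ξ i`, resp. `η i` (so that `n` is
the rank of `w`), normalised so that `‖w‖_π = ∑ ‖ξ i‖² = ∑ ‖η i‖²`. -/
structure IsOrthogonalRep {H K : Type*}
    [NormedAddCommGroup H] [InnerProductSpace ℂ H]
    [NormedAddCommGroup K] [InnerProductSpace ℂ K] {n : ℕ}
    (w : H ⊗[ℂ] K) (ξ : Fin n → H) (η : Fin n → K) : Prop where
  left_ne_zero : ∀ i, ξ i ≠ 0
  right_ne_zero : ∀ i, η i ≠ 0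
  left_orthogonal : ∀ i j, i ≠ j → inner ℂ (ξ i) (ξ j) = 0
  right_orthogonal : ∀ i j, i ≠ j → inner ℂ (η i) (η j) = 0
  eq_sum : w = ∑ i, ξ i ⊗ₜ[ℂ] η i
  norm_left : projNorm w = ∑ i, ‖ξ i‖ ^ 2
  norm_right : projNorm w = ∑ i, ‖η i‖ ^ 2

/-- `α` is a matrix of `C ⊗ D` along the orthogonal representation `w = ∑ ξ i ⊗ η i`: there is an
orthogonal representation `(C ⊗ D) w = ∑ ρ j ⊗ σ j` with the same number of terms such that
`C (ξ i) = ∑ j, α i j • ρ j`. -/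
def IsTransitionMatrix {H K : Type*}
    [NormedAddCommGroup H] [InnerProductSpace ℂ H]
    [NormedAddCommGroup K] [InnerProductSpace ℂ K] {n : ℕ}
    (C : H →L[ℂ] H) (D : K →L[ℂ] K) (w : H ⊗[ℂ] K) (ξ : Fin n → H)
    (α : Matrix (Fin n) (Fin n) ℂ) : Prop :=
  ∃ (ρ : Fin n → H) (σ : Fin n → K),
    IsOrthogonalRep (TensorProduct.map C.toLinearMap D.toLinearMap w) ρ σ ∧
    ∀ i, C (ξ i) = ∑ j, α i j • ρ j

/-- `α = U d V` is a singular value decomposition of the invertible matrix `α`: `U`, `V` are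
unitary and `d` is diagonal with strictly positive entries. -/
def IsSVD {n : ℕ} (α U : Matrix (Fin n) (Fin n) ℂ) (d : Fin n → ℝ)
    (V : Matrix (Fin n) (Fin n) ℂ) : Prop :=
  U ∈ Matrix.unitaryGroup (Fin n) ℂ ∧ V ∈ Matrix.unitaryGroup (Fin n) ℂ ∧ (∀ i, 0 < d i) ∧
    α = U * Matrix.diagonal (fun i => (d i : ℂ)) * V

/-- The condition `U = S` for the pairs `(C, D)` and `(E, F)`: every tensor `w` has an orthogonal
representation `w = ∑ ξ i ⊗ η i` for which the matrices `α` of `C ⊗ D` and `α'` of `E ⊗ F` along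
it have singular value decompositions `α = U d V`, `α' = S e T` with the same left unitary
factor `U = S`. -/
def SameLeftUnitary {H K : Type*}
    [NormedAddCommGroup H] [InnerProductSpace ℂ H]
    [NormedAddCommGroup K] [InnerProductSpace ℂ K]
    (C : H →L[ℂ] H) (D : K →L[ℂ] K) (E : H →L[ℂ] H) (F : K →L[ℂ] K) : Prop :=
  ∀ w : H ⊗[ℂ] K, ∃ (n : ℕ) (ξ : Fin n → H) (η : Fin n → K)
    (α U V α' S T : Matrix (Fin n) (Fin n) ℂ) (d e : Fin n → ℝ),
    IsOrthogonalRep w ξ η ∧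
    IsTransitionMatrix C D w ξ α ∧ IsSVD α U d V ∧
    IsTransitionMatrix E F w ξ α' ∧ IsSVD α' S e T ∧
    U = S

/-- The condition `U = S` for six operators, stated after the change of variables
`x ↦ A⁻¹ x`, `y ↦ B⁻¹ y` (used only for invertible `A` and `B`). For `A = 1`, `B = 1` it is
`SameLeftUnitary C D E F`. -/
def SameLeftUnitaryRel {H K : Type*}
    [NormedAddCommGroup H] [InnerProductSpace ℂ H]
    [NormedAddCommGroup K] [InnerProductSpace ℂ K]
    (A : H →L[ℂ] H) (B : K →L[ℂ] K) (C : H →L[ℂ] H) (D : K →L[ℂ] K)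
    (E : H →L[ℂ] H) (F : K →L[ℂ] K) : Prop :=
  SameLeftUnitary (C * Ring.inverse A) (D * Ring.inverse B)
    (E * Ring.inverse A) (F * Ring.inverse B)

/-- The regularisation `A(ε) = (A* A + ε)^{1/2}`, which is positive and invertible for `ε > 0`. -/
noncomputable def regularize {H : Type*}
    [NormedAddCommGroup H] [InnerProductSpace ℂ H] [CompleteSpace H]
    (A : H →L[ℂ] H) (ε : ℝ) : H →L[ℂ] H :=
  CFC.sqrt (ContinuousLinearMap.adjoint A * A + (ε : ℂ) • (1 : H →L[ℂ] H))

/-! By Hahn–Banach on the algebraic tensor product, for `A = B = 1` it suffices that the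
linearisation of `u` satisfies |u(w)| ≤ ‖w‖_π + ‖(C⊗D)w‖_π + ‖(E⊗F)w‖_π for every w. The hypothesis
on `u` yields this once one representation of w is optimal for all three projective norms at once.
Such a representation comes from rotating an orthogonal one by `U`. If α = U d V, the rotated
vectors satisfy Cξ'ₖ = dₖ(Vρ)ₖ and dₖDη'ₖ = (V̄σ)ₖ. The factor dₖ cancels in ‖Cξ'ₖ‖‖Dη'ₖ‖, and AM-GM
with unitarity of V bounds the sum by ‖(C⊗D)w‖_π (`sum_norm_mul_norm_le_projNorm_map`). The
condition U = S lets the same rotation serve E⊗F, and any rotation serves the identity. Invertible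
A, B reduce to this case by substitution; in general, decompositions for the regularised operators
are passed to a limit along an ultrafilter. -/

/-- **Hahn–Banach decomposition**: a functional dominated by a sum of three seminorms is a sum of
three functionals, each dominated by one of them. -/
theorem Module.Dual.exists_eq_add_add_of_le_seminorm {V : Type*} [AddCommGroup V] [Module ℂ V]
    (f : Module.Dual ℂ V) (p q r : Seminorm ℂ V) (hf : ∀ v, ‖f v‖ ≤ p v + q v + r v) :
    ∃ f₁ f₂ f₃ : Module.Dual ℂ V, f = f₁ + f₂ + f₃ ∧
      (∀ v, ‖f₁ v‖ ≤ p v) ∧ (∀ v, ‖f₂ v‖ ≤ q v) ∧ (∀ v, ‖f₃ v‖ ≤ r v) := by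
  -- On the diagonal of V³, `f` is dominated by `N`; an extension to V³ splits along the three
  -- coordinate axes.
  let Δ : V →ₗ[ℂ] V × V × V := LinearMap.id.prod (LinearMap.id.prod LinearMap.id)
  let N : Seminorm ℂ (V × V × V) :=
    p.comp (LinearMap.fst ℂ V (V × V)) +
      q.comp (LinearMap.fst ℂ V V ∘ₗ LinearMap.snd ℂ V (V × V)) +
      r.comp (LinearMap.snd ℂ V V ∘ₗ LinearMap.snd ℂ V (V × V))
  have hN (a b c : V) : N (a, b, c) = p a + q b + r c := rfl
  let φ : Module.Dual ℂ (LinearMap.range Δ) :=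
    f ∘ₗ LinearMap.fst ℂ V (V × V) ∘ₗ (LinearMap.range Δ).subtype
  obtain ⟨g, hg, hgN⟩ := Module.Dual.exists_extension_of_le_seminorm (LinearMap.range Δ) φ
    (p := N) (by rintro ⟨_, v, rfl⟩; exact hf v)
  refine ⟨g ∘ₗ LinearMap.inl ℂ V (V × V), g ∘ₗ LinearMap.inr ℂ V (V × V) ∘ₗ LinearMap.inl ℂ V V,
    g ∘ₗ LinearMap.inr ℂ V (V × V) ∘ₗ LinearMap.inr ℂ V V, ?_, fun v => ?_, fun v => ?_,
    fun v => ?_⟩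
  · ext v
    have h : g (v, v, v) = f v := hg ⟨Δ v, v, rfl⟩
    simp only [LinearMap.add_apply, LinearMap.comp_apply, ← map_add, ← h]
    simp
  · exact (hgN (v, 0, 0)).trans_eq (by simp only [hN, map_zero, add_zero])
  · exact (hgN (0, v, 0)).trans_eq (by simp only [hN, map_zero, add_zero, zero_add])
  · exact (hgN (0, 0, v)).trans_eq (by simp only [hN, map_zero, zero_add])

/-- An isometric matrix, acting on tuples of vectors, preserves the sum of squared norms. -/
theorem sum_norm_sq_sum_smul_of_conjTranspose_mul_self {H ι : Type*} [NormedAddCommGroup H]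
    [InnerProductSpace ℂ H] [Fintype ι] [DecidableEq ι] {V : Matrix ι ι ℂ}
    (hV : V.conjTranspose * V = 1) (x : ι → H) :
    ∑ k, ‖∑ j, V k j • x j‖ ^ 2 = ∑ j, ‖x j‖ ^ 2 := by
  have hentry (j l : ι) : ∑ k, star (V k j) * V k l = if j = l then 1 else 0 := by
    simpa [Matrix.mul_apply, Matrix.one_apply] using congrFun (congrFun hV j) l
  have key : ∑ k, inner ℂ (∑ j, V k j • x j) (∑ l, V k l • x l) = ∑ j, inner ℂ (x j) (x j) := by
    calc ∑ k, inner ℂ (∑ j, V k j • x j) (∑ l, V k l • x l)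
        = ∑ k, ∑ j, ∑ l, (star (V k j) * V k l) * inner ℂ (x j) (x l) := by
          simp only [sum_inner, inner_smul_left]
          simp only [inner_sum, inner_smul_right, Finset.mul_sum, mul_assoc]
          rfl
      _ = ∑ j, ∑ l, (∑ k, star (V k j) * V k l) * inner ℂ (x j) (x l) := by
          rw [Finset.sum_comm]
          refine Finset.sum_congr rfl fun j _ => ?_
          rw [Finset.sum_comm]
          simp only [Finset.sum_mul]
      _ = ∑ j, inner ℂ (x j) (x j) := by
          simp only [hentry, ite_mul, one_mul, zero_mul, Finset.sum_ite_eq, Finset.mem_univ,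
            if_true]
  simp only [inner_self_eq_norm_sq_to_K] at key
  exact_mod_cast key

/-! ### The projective seminorm -/

section ProjNorm

variable {H K : Type*} [NormedAddCommGroup H] [InnerProductSpace ℂ H]
  [NormedAddCommGroup K] [InnerProductSpace ℂ K]

theorem projNorm_sum_tmul_le {ι : Type*} [Fintype ι] (x : ι → H) (y : ι → K) :
    projNorm (∑ i, x i ⊗ₜ[ℂ] y i) ≤ ∑ i, ‖x i‖ * ‖y i‖ := by
  refine csInf_le ⟨0, ?_⟩ ?_
  · rintro _ ⟨n, x, y, -, rfl⟩
    positivity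
  · let e := Fintype.equivFin ι
    exact ⟨Fintype.card ι, x ∘ e.symm, y ∘ e.symm,
      (e.symm.sum_comp fun i => x i ⊗ₜ[ℂ] y i).symm,
      (e.symm.sum_comp fun i => ‖x i‖ * ‖y i‖).symm⟩

theorem projNorm_tmul_le (x : H) (y : K) : projNorm (x ⊗ₜ[ℂ] y) ≤ ‖x‖ * ‖y‖ := by
  simpa using projNorm_sum_tmul_le (fun _ : Unit => x) (fun _ => y)

theorem exists_sum_lt_of_projNorm_lt {w : H ⊗[ℂ] K} {r : ℝ} (h : projNorm w < r) :
    ∃ (n : ℕ) (x : Fin n → H) (y : Fin n → K),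
      w = ∑ i, x i ⊗ₜ[ℂ] y i ∧ ∑ i, ‖x i‖ * ‖y i‖ < r := by
  have hne : {r : ℝ | ∃ (n : ℕ) (x : Fin n → H) (y : Fin n → K),
      w = ∑ i, x i ⊗ₜ[ℂ] y i ∧ r = ∑ i, ‖x i‖ * ‖y i‖}.Nonempty := by
    obtain ⟨s, hs⟩ := TensorProduct.exists_finset w
    refine ⟨_, s.card, fun i => (s.equivFin.symm i).1.1, fun i => (s.equivFin.symm i).1.2, ?_, rfl⟩
    rw [hs, ← Finset.sum_coe_sort]
    exact (s.equivFin.symm.sum_comp fun i : s => i.1.1 ⊗ₜ[ℂ] i.1.2).symm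
  obtain ⟨_, ⟨n, x, y, hw, rfl⟩, hlt⟩ := exists_lt_of_csInf_lt hne h
  exact ⟨n, x, y, hw, hlt⟩

theorem projNorm_add_le (v w : H ⊗[ℂ] K) : projNorm (v + w) ≤ projNorm v + projNorm w := by
  refine le_of_forall_pos_lt_add fun ε hε => ?_
  obtain ⟨n, x, y, hv, h₁⟩ := exists_sum_lt_of_projNorm_lt (lt_add_of_pos_right (projNorm v)
    (half_pos hε))
  obtain ⟨m, x', y', hw, h₂⟩ := exists_sum_lt_of_projNorm_lt (lt_add_of_pos_right (projNorm w)
    (half_pos hε))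
  have h := projNorm_sum_tmul_le (Sum.elim x x') (Sum.elim y y')
  simp only [Fintype.sum_sum_type, Sum.elim_inl, Sum.elim_inr, ← hv, ← hw] at h
  linarith

theorem projNorm_smul_le (c : ℂ) (w : H ⊗[ℂ] K) : projNorm (c • w) ≤ ‖c‖ * projNorm w := by
  refine le_of_forall_pos_lt_add fun ε hε => ?_
  -- Dividing ε by ‖c‖ + 1 rather than ‖c‖ covers c = 0.
  have hc : 0 < ‖c‖ + 1 := by positivity
  obtain ⟨n, x, y, hw, h₁⟩ := exists_sum_lt_of_projNorm_lt (lt_add_of_pos_right (projNorm w)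
    (div_pos hε hc))
  have h := projNorm_sum_tmul_le (fun i => c • x i) y
  simp only [← TensorProduct.smul_tmul', norm_smul, mul_assoc, ← Finset.mul_sum] at h
  rw [← Finset.smul_sum, ← hw] at h
  calc projNorm (c • w) ≤ ‖c‖ * ∑ i, ‖x i‖ * ‖y i‖ := h
    _ ≤ ‖c‖ * (projNorm w + ε / (‖c‖ + 1)) := by gcongr
    _ = ‖c‖ * projNorm w + ‖c‖ / (‖c‖ + 1) * ε := by ring
    _ < ‖c‖ * projNorm w + ε := by
      gcongr
      exact mul_lt_of_lt_one_left hε ((div_lt_one hc).2 (lt_add_one _))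

/-- The projective norm as a seminorm. -/
noncomputable def projSeminorm : Seminorm ℂ (H ⊗[ℂ] K) :=
  Seminorm.ofSMulLE projNorm
    (le_antisymm (by simpa using projNorm_tmul_le (0 : H) (0 : K))
      (Real.sInf_nonneg (by rintro _ ⟨n, x, y, -, rfl⟩; positivity)))
    projNorm_add_le projNorm_smul_le

/-! ### Rotated orthogonal representations -/

/-- A tensor does not change if its factors are rotated by a unitary matrix and its conjugate. -/
theorem sum_tmul_eq_sum_tmul_of_mem_unitaryGroup {ι : Type*} [Fintype ι] [DecidableEq ι]
    {U : Matrix ι ι ℂ} (hU : U ∈ Matrix.unitaryGroup ι ℂ) (x : ι → H) (y : ι → K) :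
    ∑ i, x i ⊗ₜ[ℂ] y i = ∑ k, (∑ i, star (U i k) • x i) ⊗ₜ[ℂ] (∑ i, U i k • y i) := by
  have hentry (i j : ι) : ∑ k, star (U i k) * U j k = if j = i then 1 else 0 := by
    have h := congrFun (congrFun (Matrix.mem_unitaryGroup_iff.1 hU) j) i
    simpa [Matrix.mul_apply, Matrix.one_apply, mul_comm] using h
  symm
  calc ∑ k, (∑ i, star (U i k) • x i) ⊗ₜ[ℂ] (∑ i, U i k • y i)
      = ∑ k, ∑ i, ∑ j, (star (U i k) * U j k) • x i ⊗ₜ[ℂ] y j := by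
        simp only [TensorProduct.sum_tmul]
        simp only [TensorProduct.tmul_sum, TensorProduct.smul_tmul_smul]
    _ = ∑ i, ∑ j, (∑ k, star (U i k) * U j k) • x i ⊗ₜ[ℂ] y j := by
        rw [Finset.sum_comm]
        refine Finset.sum_congr rfl fun i _ => ?_
        rw [Finset.sum_comm]
        simp only [Finset.sum_smul]
    _ = ∑ i, x i ⊗ₜ[ℂ] y i := by
        simp only [hentry, ite_smul, one_smul, zero_smul, Finset.sum_ite_eq', Finset.mem_univ,
          if_true]

/-- In a tensor `∑ ρ j ⊗ σ j` with nonzero orthogonal `ρ j`, the vectors `σ j` are unique. -/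
theorem eq_of_sum_tmul_eq_sum_tmul {ι : Type*} [Fintype ι] {ρ : ι → H} {σ τ : ι → K}
    (h0 : ∀ i, ρ i ≠ 0) (ho : ∀ i j, i ≠ j → inner ℂ (ρ i) (ρ j) = 0)
    (h : ∑ j, ρ j ⊗ₜ[ℂ] σ j = ∑ j, ρ j ⊗ₜ[ℂ] τ j) (j : ι) : σ j = τ j := by
  classical
  -- Contracting the first factor against `ρ j` leaves only the j-th term.
  have h' := congrArg ((TensorProduct.lid ℂ K).toLinearMap ∘ₗ
    TensorProduct.map (innerSL ℂ (ρ j)).toLinearMap (LinearMap.id : K →ₗ[ℂ] K)) h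
  have hsum (υ : ι → K) : ∑ i, inner ℂ (ρ j) (ρ i) • υ i = inner ℂ (ρ j) (ρ j) • υ j :=
    Finset.sum_eq_single j (fun i _ hi => by rw [ho j i hi.symm, zero_smul]) (by simp)
  simp only [map_sum, LinearMap.comp_apply, TensorProduct.map_tmul] at h'
  have h2 : inner ℂ (ρ j) (ρ j) • σ j = inner ℂ (ρ j) (ρ j) • τ j := by
    rw [← hsum, ← hsum]
    simpa using h'
  exact smul_right_injective K (inner_self_ne_zero.2 (h0 j)) h2

/-- Rotating an orthogonal representation of `w` by the left unitary factor of the matrix of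
`C ⊗ D` gives a representation which computes the projective norm of `(C ⊗ D) w`. -/
theorem sum_norm_mul_norm_le_projNorm_map {n : ℕ} {C : H →L[ℂ] H} {D : K →L[ℂ] K} {w : H ⊗[ℂ] K}
    {ξ : Fin n → H} {η : Fin n → K} {α U V : Matrix (Fin n) (Fin n) ℂ} {d : Fin n → ℝ}
    (hw : IsOrthogonalRep w ξ η) (hα : IsTransitionMatrix C D w ξ α) (hsvd : IsSVD α U d V) :
    ∑ k, ‖C (∑ i, star (U i k) • ξ i)‖ * ‖D (∑ i, U i k • η i)‖ ≤
      projNorm (TensorProduct.map C.toLinearMap D.toLinearMap w) := by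
  obtain ⟨ρ, σ, hρσ, hC⟩ := hα
  obtain ⟨hU, hV, hd, hαeq⟩ := hsvd
  have hUα : U.conjTranspose * α = Matrix.diagonal (fun i => (d i : ℂ)) * V := by
    rw [hαeq, ← Matrix.mul_assoc, ← Matrix.mul_assoc, ← Matrix.star_eq_conjTranspose,
      Matrix.mem_unitaryGroup_iff'.1 hU, Matrix.one_mul]
  have hαV : α * V.conjTranspose = U * Matrix.diagonal (fun i => (d i : ℂ)) := by
    rw [hαeq, Matrix.mul_assoc, ← Matrix.star_eq_conjTranspose, Matrix.mem_unitaryGroup_iff.1 hV,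
      Matrix.mul_one]
  -- Expanding (C⊗D)w along ξ, η and collecting the ρⱼ exhibits these as right factors, which are
  -- unique.
  have hσ (j : Fin n) : σ j = ∑ i, α i j • D (η i) := by
    refine eq_of_sum_tmul_eq_sum_tmul (τ := fun j => ∑ i, α i j • D (η i)) hρσ.left_ne_zero
      hρσ.left_orthogonal ?_ j
    rw [← hρσ.eq_sum, hw.eq_sum, map_sum]
    simp only [TensorProduct.map_tmul, ContinuousLinearMap.coe_coe, hC, TensorProduct.sum_tmul,
      TensorProduct.tmul_sum, TensorProduct.smul_tmul]
    exact Finset.sum_comm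
  have hCk (k : Fin n) : C (∑ i, star (U i k) • ξ i) = (d k : ℂ) • ∑ j, V k j • ρ j := by
    have hentry (j : Fin n) : ∑ i, star (U i k) * α i j = d k * V k j := by
      have h := congrFun (congrFun hUα k) j
      rwa [Matrix.diagonal_mul, Matrix.mul_apply] at h
    simp only [map_sum, map_smul, hC, Finset.smul_sum, smul_smul]
    rw [Finset.sum_comm]
    simp only [← Finset.sum_smul, hentry]
  -- The transpose of α acts on the right factors, so V enters conjugated; keeping dₖ on the left
  -- avoids dividing by it.
  have hDk (k : Fin n) : (d k : ℂ) • D (∑ i, U i k • η i) = ∑ j, star (V k j) • σ j := by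
    have hentry (i : Fin n) : ∑ j, star (V k j) * α i j = d k * U i k := by
      have h := congrFun (congrFun hαV i) k
      rw [Matrix.mul_diagonal, mul_comm] at h
      rw [← h]
      simp [Matrix.mul_apply, mul_comm]
    simp only [map_sum, map_smul, hσ, Finset.smul_sum, smul_smul]
    rw [Finset.sum_comm]
    simp only [← Finset.sum_smul, hentry]
  have hnorm (k : Fin n) : ‖C (∑ i, star (U i k) • ξ i)‖ * ‖D (∑ i, U i k • η i)‖ =
      ‖∑ j, V k j • ρ j‖ * ‖∑ j, star (V k j) • σ j‖ := by
    rw [hCk, ← hDk, norm_smul, norm_smul]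
    ring
  have hVV : V.conjTranspose * V = 1 := Matrix.mem_unitaryGroup_iff'.1 hV
  have hVV' : (V.map star).conjTranspose * V.map star = 1 := by
    have h := congrArg (fun M : Matrix (Fin n) (Fin n) ℂ => M.transpose) hVV
    ext i j
    have h' := congrFun (congrFun h i) j
    simp only [Matrix.transpose_apply, Matrix.mul_apply, Matrix.conjTranspose_apply,
      Matrix.map_apply, star_star, Matrix.one_apply] at h' ⊢
    simp only [mul_comm (V _ i), h', eq_comm]
  have h1 := sum_norm_sq_sum_smul_of_conjTranspose_mul_self hVV ρ
  have h2 := sum_norm_sq_sum_smul_of_conjTranspose_mul_self hVV' σ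
  rw [← hρσ.norm_left] at h1
  rw [← hρσ.norm_right] at h2
  simp only [Matrix.map_apply] at h2
  -- AM-GM; both sums of squares on the right equal the projective norm of (C⊗D)w.
  have h3 : ∑ k, 2 * (‖∑ j, V k j • ρ j‖ * ‖∑ j, star (V k j) • σ j‖) ≤
      ∑ k, ‖∑ j, V k j • ρ j‖ ^ 2 + ∑ k, ‖∑ j, star (V k j) • σ j‖ ^ 2 := by
    rw [← Finset.sum_add_distrib]
    refine Finset.sum_le_sum fun k _ => ?_
    rw [← mul_assoc]
    exact two_mul_le_add_sq _ _
  rw [← Finset.mul_sum, h1, h2] at h3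
  simp only [hnorm]
  linarith

theorem IsOrthogonalRep.isTransitionMatrix_one {n : ℕ} {w : H ⊗[ℂ] K} {ξ : Fin n → H}
    {η : Fin n → K} (hw : IsOrthogonalRep w ξ η) :
    IsTransitionMatrix (1 : H →L[ℂ] H) (1 : K →L[ℂ] K) w ξ 1 := by
  refine ⟨ξ, η, ?_, fun i => by simp [Matrix.one_apply]⟩
  have h : TensorProduct.map (1 : H →L[ℂ] H).toLinearMap (1 : K →L[ℂ] K).toLinearMap w = w :=
    DFunLike.congr_fun (TensorProduct.map_id (R := ℂ) (M := H) (N := K)) w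
  rwa [h]

/-- The identity matrix admits every unitary as left factor, so the summand ‖x‖‖y‖ puts no
constraint on the rotation. -/
theorem isSVD_one {n : ℕ} {U : Matrix (Fin n) (Fin n) ℂ}
    (hU : U ∈ Matrix.unitaryGroup (Fin n) ℂ) : IsSVD 1 U (fun _ => 1) (star U) := by
  refine ⟨hU, Unitary.star_mem hU, fun _ => one_pos, ?_⟩
  simp [Matrix.mem_unitaryGroup_iff.1 hU]

/-! ### Decomposition for invertible A and B -/

/-- Under the condition `U = S`, a bilinear form dominated by `‖x‖‖y‖ + ‖C x‖‖D y‖ + ‖E x‖‖F y‖`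
is dominated on all tensors by the sum of the corresponding projective seminorms. -/
theorem SameLeftUnitary.norm_lift_le {C E : H →L[ℂ] H} {D F : K →L[ℂ] K}
    (h : SameLeftUnitary C D E F) {u : H →ₗ[ℂ] K →ₗ[ℂ] ℂ}
    (hu : ∀ x y, ‖u x y‖ ≤ ‖x‖ * ‖y‖ + ‖C x‖ * ‖D y‖ + ‖E x‖ * ‖F y‖) (w : H ⊗[ℂ] K) :
    ‖TensorProduct.lift u w‖ ≤ projNorm w +
      projNorm (TensorProduct.map C.toLinearMap D.toLinearMap w) +
      projNorm (TensorProduct.map E.toLinearMap F.toLinearMap w) := by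
  obtain ⟨n, ξ, η, α, U, V, α', S, T, d, e, hw, hα, hsvd, hα', hsvd', rfl⟩ := h w
  have h₁ := sum_norm_mul_norm_le_projNorm_map hw hw.isTransitionMatrix_one (isSVD_one hsvd.1)
  have h₂ := sum_norm_mul_norm_le_projNorm_map hw hα hsvd
  have h₃ := sum_norm_mul_norm_le_projNorm_map hw hα' hsvd'
  have hid : TensorProduct.map (1 : H →L[ℂ] H).toLinearMap (1 : K →L[ℂ] K).toLinearMap w = w :=
    DFunLike.congr_fun (TensorProduct.map_id (R := ℂ) (M := H) (N := K)) w
  rw [hid] at h₁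
  refine le_trans ?_ (add_le_add (add_le_add h₁ h₂) h₃)
  rw [← Finset.sum_add_distrib, ← Finset.sum_add_distrib]
  conv_lhs => rw [hw.eq_sum, sum_tmul_eq_sum_tmul_of_mem_unitaryGroup hsvd.1 ξ η, map_sum]
  refine (norm_sum_le _ _).trans (Finset.sum_le_sum fun k _ => ?_)
  rw [TensorProduct.lift.tmul]
  exact hu _ _

theorem SameLeftUnitary.exists_decomposition {C E : H →L[ℂ] H} {D F : K →L[ℂ] K}
    (h : SameLeftUnitary C D E F) {u : H →ₗ[ℂ] K →ₗ[ℂ] ℂ}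
    (hu : ∀ x y, ‖u x y‖ ≤ ‖x‖ * ‖y‖ + ‖C x‖ * ‖D y‖ + ‖E x‖ * ‖F y‖) :
    ∃ u₁ u₂ u₃ : H →ₗ[ℂ] K →ₗ[ℂ] ℂ, u = u₁ + u₂ + u₃ ∧
      (∀ x y, ‖u₁ x y‖ ≤ ‖x‖ * ‖y‖) ∧
      (∀ x y, ‖u₂ x y‖ ≤ ‖C x‖ * ‖D y‖) ∧
      (∀ x y, ‖u₃ x y‖ ≤ ‖E x‖ * ‖F y‖) := by
  obtain ⟨f₁, f₂, f₃, hf, h₁, h₂, h₃⟩ :=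
    Module.Dual.exists_eq_add_add_of_le_seminorm (TensorProduct.lift u) projSeminorm
      (projSeminorm.comp (TensorProduct.map C.toLinearMap D.toLinearMap))
      (projSeminorm.comp (TensorProduct.map E.toLinearMap F.toLinearMap)) (h.norm_lift_le hu)
  refine ⟨TensorProduct.curry f₁, TensorProduct.curry f₂, TensorProduct.curry f₃, ?_,
    fun x y => (h₁ _).trans (projNorm_tmul_le _ _), fun x y => (h₂ _).trans ?_,
    fun x y => (h₃ _).trans ?_⟩
  · ext x y
    simpa using DFunLike.congr_fun hf (x ⊗ₜ[ℂ] y)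
  · exact projNorm_tmul_le (C x) (D y)
  · exact projNorm_tmul_le (E x) (F y)

/-- Decompose u(A⁻¹x, B⁻¹y), then compose the pieces with A and B. -/
theorem SameLeftUnitaryRel.exists_decomposition {A C E : H →L[ℂ] H} {B D F : K →L[ℂ] K}
    (hA : IsUnit A) (hB : IsUnit B) (h : SameLeftUnitaryRel A B C D E F)
    {u : H →ₗ[ℂ] K →ₗ[ℂ] ℂ}
    (hu : ∀ x y, ‖u x y‖ ≤ ‖A x‖ * ‖B y‖ + ‖C x‖ * ‖D y‖ + ‖E x‖ * ‖F y‖) :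
    ∃ u₁ u₂ u₃ : H →ₗ[ℂ] K →ₗ[ℂ] ℂ, u = u₁ + u₂ + u₃ ∧
      (∀ x y, ‖u₁ x y‖ ≤ ‖A x‖ * ‖B y‖) ∧
      (∀ x y, ‖u₂ x y‖ ≤ ‖C x‖ * ‖D y‖) ∧
      (∀ x y, ‖u₃ x y‖ ≤ ‖E x‖ * ‖F y‖) := by
  have hAr (x : H) : A (Ring.inverse A x) = x :=
    DFunLike.congr_fun (Ring.mul_inverse_cancel A hA) x
  have hAl (x : H) : Ring.inverse A (A x) = x :=
    DFunLike.congr_fun (Ring.inverse_mul_cancel A hA) x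
  have hBr (y : K) : B (Ring.inverse B y) = y :=
    DFunLike.congr_fun (Ring.mul_inverse_cancel B hB) y
  have hBl (y : K) : Ring.inverse B (B y) = y :=
    DFunLike.congr_fun (Ring.inverse_mul_cancel B hB) y
  obtain ⟨v₁, v₂, v₃, hv, h₁, h₂, h₃⟩ := SameLeftUnitary.exists_decomposition h
    (u := u.compl₁₂ (Ring.inverse A).toLinearMap (Ring.inverse B).toLinearMap)
    (fun x y => by simpa [hAr, hBr] using hu (Ring.inverse A x) (Ring.inverse B y))
  refine ⟨v₁.compl₁₂ A.toLinearMap B.toLinearMap, v₂.compl₁₂ A.toLinearMap B.toLinearMap,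
    v₃.compl₁₂ A.toLinearMap B.toLinearMap, ?_, fun x y => h₁ (A x) (B y), fun x y => ?_,
    fun x y => ?_⟩
  · ext x y
    simpa [hAl, hBl] using DFunLike.congr_fun (DFunLike.congr_fun hv (A x)) (B y)
  · simpa [hAl, hBl] using h₂ (A x) (B y)
  · simpa [hAl, hBl] using h₃ (A x) (B y)

end ProjNorm

/-! ### Regularised operators -/

section Regularize

variable {H : Type*} [NormedAddCommGroup H] [InnerProductSpace ℂ H] [CompleteSpace H]

theorem isStrictlyPositive_adjoint_mul_self_add_smul_one (A : H →L[ℂ] H) {ε : ℝ} (hε : 0 < ε) :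
    IsStrictlyPositive (ContinuousLinearMap.adjoint A * A + (ε : ℂ) • (1 : H →L[ℂ] H)) := by
  refine IsStrictlyPositive.nonneg_add (star_mul_self_nonneg A) ⟨?_, ?_⟩
  · rw [Complex.coe_smul]
    exact smul_nonneg hε.le zero_le_one
  · have h : IsUnit (algebraMap ℂ (H →L[ℂ] H) ε) :=
      (IsUnit.mk0 (ε : ℂ) (by exact_mod_cast hε.ne')).map _
    rwa [Algebra.algebraMap_eq_smul_one] at h

theorem isUnit_regularize (A : H →L[ℂ] H) {ε : ℝ} (hε : 0 < ε) : IsUnit (regularize A ε) :=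
  (isStrictlyPositive_adjoint_mul_self_add_smul_one A hε).isUnit_cfcSqrt

/-- Since A(ε) is self-adjoint, ‖A(ε)x‖² = ⟨x, (A*A + ε)x⟩. Domination of ‖Ax‖ and convergence to it
as ε → 0 both follow. -/
theorem norm_regularize_apply (A : H →L[ℂ] H) {ε : ℝ} (hε : 0 < ε) (x : H) :
    ‖regularize A ε x‖ = √(‖A x‖ ^ 2 + ε * ‖x‖ ^ 2) := by
  have hsa : ContinuousLinearMap.adjoint (regularize A ε) = regularize A ε :=
    (IsSelfAdjoint.of_nonneg (CFC.sqrt_nonneg _)).star_eq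
  have hsq : regularize A ε * regularize A ε =
      ContinuousLinearMap.adjoint A * A + (ε : ℂ) • (1 : H →L[ℂ] H) :=
    CFC.sqrt_mul_sqrt_self _ (isStrictlyPositive_adjoint_mul_self_add_smul_one A hε).nonneg
  rw [eq_comm, Real.sqrt_eq_iff_mul_self_eq (by positivity) (norm_nonneg _)]
  have h : inner ℂ (regularize A ε x) (regularize A ε x) =
      inner ℂ (A x) (A x) + ε * inner ℂ x x := by
    calc inner ℂ (regularize A ε x) (regularize A ε x)
        = inner ℂ x ((regularize A ε * regularize A ε) x) := by
          rw [← ContinuousLinearMap.adjoint_inner_right, hsa]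
          rfl
      _ = inner ℂ x (ContinuousLinearMap.adjoint A (A x) + (ε : ℂ) • x) := by rw [hsq]; rfl
      _ = inner ℂ (A x) (A x) + ε * inner ℂ x x := by
          rw [inner_add_right, inner_smul_right, ContinuousLinearMap.adjoint_inner_right]
  simp only [inner_self_eq_norm_sq_to_K] at h
  rw [← sq]
  apply Complex.ofReal_injective
  push_cast
  exact h.symm

theorem norm_apply_le_norm_regularize_apply (A : H →L[ℂ] H) {ε : ℝ} (hε : 0 < ε) (x : H) :
    ‖A x‖ ≤ ‖regularize A ε x‖ := by
  rw [norm_regularize_apply A hε]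
  exact Real.le_sqrt_of_sq_le (le_add_of_nonneg_right (by positivity))

theorem tendsto_norm_regularize_apply (A : H →L[ℂ] H) (x : H) :
    Tendsto (fun ε => ‖regularize A ε x‖) (𝓝[>] 0) (𝓝 ‖A x‖) := by
  have h : Tendsto (fun ε : ℝ => √(‖A x‖ ^ 2 + ε * ‖x‖ ^ 2)) (𝓝[>] 0) (𝓝 ‖A x‖) := by
    refine tendsto_nhdsWithin_of_tendsto_nhds ?_
    have hc : Continuous fun ε : ℝ => √(‖A x‖ ^ 2 + ε * ‖x‖ ^ 2) := by fun_prop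
    simpa using hc.tendsto 0
  refine h.congr' ?_
  filter_upwards [self_mem_nhdsWithin] with ε hε
  exact (norm_regularize_apply A hε x).symm

end Regularize

/-! ### Passage to the limit -/

/-- Along an ultrafilter, bilinear forms with convergent pointwise bounds converge pointwise to
a bilinear form that obeys the limiting bound. -/
theorem exists_tendsto_bilinear_of_ultrafilter {X H K : Type*} [AddCommGroup H] [Module ℂ H]
    [AddCommGroup K] [Module ℂ K] (l : Ultrafilter X) {v : X → H →ₗ[ℂ] K →ₗ[ℂ] ℂ}
    {b : X → H → K → ℝ} {c : H → K → ℝ} (hv : ∀ᶠ ε in l, ∀ x y, ‖v ε x y‖ ≤ b ε x y)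
    (hb : ∀ x y, Tendsto (fun ε => b ε x y) l (𝓝 (c x y))) :
    ∃ v₀ : H →ₗ[ℂ] K →ₗ[ℂ] ℂ,
      (∀ x y, Tendsto (fun ε => v ε x y) l (𝓝 (v₀ x y))) ∧ ∀ x y, ‖v₀ x y‖ ≤ c x y := by
  have hlim (x : H) (y : K) : ∃ z, Tendsto (fun ε => v ε x y) l (𝓝 z) := by
    -- The values eventually lie in a compact disc, where an ultrafilter must converge.
    have hmem : ∀ᶠ ε in l, v ε x y ∈ Metric.closedBall (0 : ℂ) (c x y + 1) := by
      filter_upwards [hv, (hb x y).eventually_le_const (lt_add_one (c x y))] with ε h₁ h₂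
      simpa using (h₁ x y).trans h₂
    obtain ⟨z, -, hz⟩ := (isCompact_closedBall (0 : ℂ) (c x y + 1)).ultrafilter_le_nhds'
      (l.map fun ε => v ε x y) hmem
    exact ⟨z, hz⟩
  choose z hz using hlim
  refine ⟨LinearMap.mk₂ ℂ z ?_ ?_ ?_ ?_, hz, fun x y => ?_⟩
  · exact fun x x' y => tendsto_nhds_unique (hz _ _) (by simpa using (hz x y).add (hz x' y))
  · exact fun a x y => tendsto_nhds_unique (hz _ _) (by simpa using (hz x y).const_mul a)
  · exact fun x y y' => tendsto_nhds_unique (hz _ _) (by simpa using (hz x y).add (hz x y'))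
  · exact fun a x y => tendsto_nhds_unique (hz _ _) (by simpa using (hz x y).const_mul a)
  · exact le_of_tendsto_of_tendsto (hz x y).norm (hb x y) (hv.mono fun ε h => h x y)

theorem mainTheorem4 {H K : Type*}
    [NormedAddCommGroup H] [InnerProductSpace ℂ H] [CompleteSpace H]
    [NormedAddCommGroup K] [InnerProductSpace ℂ K] [CompleteSpace K]
    (A C E : H →L[ℂ] H) (B D F : K →L[ℂ] K)
    (u : H →ₗ[ℂ] K →ₗ[ℂ] ℂ)
    (hu : ∀ x y, ‖u x y‖ ≤ ‖A x‖ * ‖B y‖ + ‖C x‖ * ‖D y‖ + ‖E x‖ * ‖F y‖)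
    (hUS :
      ((IsUnit A ∧ IsUnit B ∧ IsUnit C ∧ IsUnit D ∧ IsUnit E ∧ IsUnit F) ∧
        SameLeftUnitaryRel A B C D E F) ∨
      (∃ᶠ ε in 𝓝[>] (0 : ℝ),
        SameLeftUnitaryRel (regularize A ε) (regularize B ε) (regularize C ε)
          (regularize D ε) (regularize E ε) (regularize F ε))) :
    ∃ u₁ u₂ u₃ : H →ₗ[ℂ] K →ₗ[ℂ] ℂ,
      u = u₁ + u₂ + u₃ ∧
      (∀ x y, ‖u₁ x y‖ ≤ ‖A x‖ * ‖B y‖) ∧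
      (∀ x y, ‖u₂ x y‖ ≤ ‖C x‖ * ‖D y‖) ∧
      (∀ x y, ‖u₃ x y‖ ≤ ‖E x‖ * ‖F y‖) := by
  rcases hUS with ⟨⟨hA, hB, -⟩, h⟩ | h
  · exact h.exists_decomposition hA hB hu
  have hfreq := h.and_eventually (self_mem_nhdsWithin : Set.Ioi (0 : ℝ) ∈ 𝓝[>] (0 : ℝ))
  -- One ultrafilter, tending to 0 from the right and concentrated on the good ε, serves all three
  -- limits.
  obtain ⟨l, hl'⟩ := @Filter.exists_ultrafilter_le _ _ (frequently_iff_neBot.1 hfreq)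
  obtain ⟨hl, hlUS⟩ := le_inf_iff.1 hl'
  rw [le_principal_iff] at hlUS
  have hdec (ε : ℝ) : ∃ u₁ u₂ u₃ : H →ₗ[ℂ] K →ₗ[ℂ] ℂ,
      SameLeftUnitaryRel (regularize A ε) (regularize B ε) (regularize C ε)
          (regularize D ε) (regularize E ε) (regularize F ε) ∧ ε ∈ Set.Ioi (0 : ℝ) →
        u = u₁ + u₂ + u₃ ∧
        (∀ x y, ‖u₁ x y‖ ≤ ‖regularize A ε x‖ * ‖regularize B ε y‖) ∧
        (∀ x y, ‖u₂ x y‖ ≤ ‖regularize C ε x‖ * ‖regularize D ε y‖) ∧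
        (∀ x y, ‖u₃ x y‖ ≤ ‖regularize E ε x‖ * ‖regularize F ε y‖) := by
    by_cases hε : SameLeftUnitaryRel (regularize A ε) (regularize B ε) (regularize C ε)
          (regularize D ε) (regularize E ε) (regularize F ε) ∧ ε ∈ Set.Ioi (0 : ℝ)
    · obtain ⟨u₁, u₂, u₃, hdec⟩ := hε.1.exists_decomposition (isUnit_regularize A hε.2)
        (isUnit_regularize B hε.2) (u := u) fun x y => (hu x y).trans (by
          gcongr <;> exact norm_apply_le_norm_regularize_apply _ hε.2 _)
      exact ⟨u₁, u₂, u₃, fun _ => hdec⟩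
    -- Junk value at bad ε, which `l` ignores; it makes the choice total in ε.
    · exact ⟨0, 0, 0, fun h => absurd h hε⟩
  choose v₁ v₂ v₃ hv using hdec
  have htendsto {P : H →L[ℂ] H} {Q : K →L[ℂ] K} (x : H) (y : K) :
      Tendsto (fun ε => ‖regularize P ε x‖ * ‖regularize Q ε y‖) l (𝓝 (‖P x‖ * ‖Q y‖)) :=
    ((tendsto_norm_regularize_apply P x).mul (tendsto_norm_regularize_apply Q y)).mono_left hl
  obtain ⟨u₁, ht₁, h₁⟩ := exists_tendsto_bilinear_of_ultrafilter l
    (Eventually.mono hlUS fun ε hε => (hv ε hε).2.1) htendsto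
  obtain ⟨u₂, ht₂, h₂⟩ := exists_tendsto_bilinear_of_ultrafilter l
    (Eventually.mono hlUS fun ε hε => (hv ε hε).2.2.1) htendsto
  obtain ⟨u₃, ht₃, h₃⟩ := exists_tendsto_bilinear_of_ultrafilter l
    (Eventually.mono hlUS fun ε hε => (hv ε hε).2.2.2) htendsto
  refine ⟨u₁, u₂, u₃, ?_, h₁, h₂, h₃⟩
  ext x y
  refine tendsto_nhds_unique (tendsto_const_nhds (f := (l : Filter ℝ))) ?_
  refine (((ht₁ x y).add (ht₂ x y)).add (ht₃ x y)).congr' ?_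
  filter_upwards [hlUS] with ε hε
  exact (DFunLike.congr_fun (DFunLike.congr_fun (hv ε hε).1 x) y).symm
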